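/- Let $\Omega\subset\mathbb{R}^2$ be open and simply connected (in particular nonempty and connected), let $r>0$ and $\delta\in\mathbb{R}$ be constants, and let $n=(n_1,n_2):\Omega\to S^1$; put $\vec n=(n_1,n_2,0)$. Assume that the field $$G(x',x_3)=G(x')=r^{2\delta}\big(\mathrm{Id}_3+(r^2-1)\,\vec n(x')\otimes\vec n(x')\big),\qquad x'\in\Omega,$$ is smooth on $\Omega$ (for instance, that $n$ is smooth), and regard it as a Riemannian metric on $\Omega^1=\Omega\times(-\tfrac12,\tfrac12)$. Denote by $G_{2\times2}$ its upper left $2\times 2$ block, and for a planar matrix field $F$ put $\mathrm{curl}^T\mathrm{curl}\,F=\partial_1(\partial_1F_{22}-\partial_2F_{21})-\partial_2(\partial_1F_{12}-\partial_2F_{11})$. For a metric $g=[g_{ij}]$ with inverse $[g^{ij}]$ let $$\Gamma^i_{kl}=\tfrac12\sum_m g^{im}(\partial_lg_{mk}+\partial_kg_{ml}-\partial_mg_{kl}),$$ $$R^s_{ijk}=\partial_j\Gamma^s_{ik}-\partial_k\Gamma^s_{ij}+\sum_m\Gamma^s_{jm}\Gamma^m_{ik}-\sum_m\Gamma^s_{km}\Gamma^m_{ij},\qquad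 R_{sijk}=\sum_m g_{sm}R^m_{ijk},$$ and, for a metric $g$ in two dimensions, let $\kappa(g)=R_{1212}/\det g$ be its Gaussian curvature. Then the following conditions are equivalent: (i) $G$ is immersible, i.e. there is a smooth $u:\Omega^1\to\mathbb{R}^3$ with $(\nabla u)^T\nabla u=G$ on $\Omega^1$; (ii) the Gaussian curvature $\kappa\big(\mathrm{Id}_2+(r^2-1)\,n\otimes n\big)$ vanishes identically in $\Omega$; (iii) $\mathrm{curl}^T\mathrm{curl}\,G_{2\times2}=0$ in $\Omega$; (iv) the curvatures $R^3_{112}$, $R^3_{221}$ and $R_{1212}$ of the metric $G$ vanish identically in $\Omega^1$. -/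

import Mathlib

open scoped ContDiff Matrix

noncomputable section

namespace NematicPlate

/-- The partial derivative `∂ᵢ f` at `x` of a scalar function on `ℝᵈ`. -/
def pd {d : ℕ} (i : Fin d) (f : (Fin d → ℝ) → ℝ) (x : Fin d → ℝ) : ℝ :=
  fderiv ℝ f x (Pi.single i 1)

/-- The Jacobian matrix `(∇u)ᵢⱼ = ∂ⱼ uᵢ` of a map `u : ℝᵈ → ℝᵉ`. -/
def jacobian {d e : ℕ} (u : (Fin d → ℝ) → (Fin e → ℝ)) (x : Fin d → ℝ) :
    Matrix (Fin e) (Fin d) ℝ :=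
  Matrix.of fun i j => pd j (fun y => u y i) x

/-- The plate `Ωʰ = Ω × (-h/2, h/2)` with mid-plate `Ω ⊆ ℝ²`. -/
def plate (Ω : Set (Fin 2 → ℝ)) (h : ℝ) : Set (Fin 3 → ℝ) :=
  {x | ![x 0, x 1] ∈ Ω ∧ |x 2| < h / 2}

/-- The extension of a field on the mid-plate to a field on `ℝ³` that is independent of `x₃`:
`F (x', x₃) = F x'`. -/
def uniformThrough {α : Type*} (F : (Fin 2 → ℝ) → α) (x : Fin 3 → ℝ) : α :=
  F ![x 0, x 1]

/-- The Christoffel symbols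
`Γⁱₖₗ = (1/2) ∑ₘ gⁱᵐ (∂ₗ gₘₖ + ∂ₖ gₘₗ - ∂ₘ gₖₗ)` of a metric `g` on a subset of `ℝᵈ`. -/
def christoffel {d : ℕ} (g : (Fin d → ℝ) → Matrix (Fin d) (Fin d) ℝ)
    (i k l : Fin d) (x : Fin d → ℝ) : ℝ :=
  1 / 2 * ∑ m, (g x)⁻¹ i m *
    (pd l (fun y => g y m k) x + pd k (fun y => g y m l) x - pd m (fun y => g y k l) x)

/-- The Riemann tensor
`Rˢᵢⱼₖ = ∂ⱼ Γˢᵢₖ - ∂ₖ Γˢᵢⱼ + ∑ₘ Γˢⱼₘ Γᵐᵢₖ - ∑ₘ Γˢₖₘ Γᵐᵢⱼ`. -/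
def riemann {d : ℕ} (g : (Fin d → ℝ) → Matrix (Fin d) (Fin d) ℝ)
    (s i j k : Fin d) (x : Fin d → ℝ) : ℝ :=
  pd j (christoffel g s i k) x - pd k (christoffel g s i j) x
    + ∑ m, christoffel g s j m x * christoffel g m i k x
    - ∑ m, christoffel g s k m x * christoffel g m i j x

/-- The covariant Riemann tensor `Rₛᵢⱼₖ = ∑ₘ gₛₘ Rᵐᵢⱼₖ`. -/
def riemannCov {d : ℕ} (g : (Fin d → ℝ) → Matrix (Fin d) (Fin d) ℝ)
    (s i j k : Fin d) (x : Fin d → ℝ) : ℝ :=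
  ∑ m, g x s m * riemann g m i j k x

/-- The Gaussian curvature `κ = R₁₂₁₂ / det g` of a metric on a subset of `ℝ²`. -/
def gaussCurvature (g : (Fin 2 → ℝ) → Matrix (Fin 2) (Fin 2) ℝ) (x : Fin 2 → ℝ) : ℝ :=
  riemannCov g 0 1 0 1 x / (g x).det

/-- The scalar curl `∂₁ v₂ - ∂₂ v₁` of a planar vector field. -/
def curl (v : (Fin 2 → ℝ) → (Fin 2 → ℝ)) (x : Fin 2 → ℝ) : ℝ :=
  pd 0 (fun y => v y 1) x - pd 1 (fun y => v y 0) x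

/-- `curlᵀ curl F`: the curl of the vector field formed by the curls of the rows of `F`. For
symmetric `F` it is `∂₂₂ F₁₁ - 2 ∂₁₂ F₁₂ + ∂₁₁ F₂₂`. -/
def curlTcurl (F : (Fin 2 → ℝ) → Matrix (Fin 2) (Fin 2) ℝ) (x : Fin 2 → ℝ) : ℝ :=
  curl (fun y i => curl (fun z => F z i) y) x

/-- The metric `r^(2δ) (Id₃ + (r² - 1) n⃗ ⊗ n⃗)` for a vector `n⃗ ∈ ℝ³`. -/
def nematic (r δ : ℝ) (n : Fin 3 → ℝ) : Matrix (Fin 3) (Fin 3) ℝ :=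
  r ^ (2 * δ) • (1 + (r ^ 2 - 1) • Matrix.vecMulVec n n)

/-- The field `G (x') = r^(2δ) (Id₃ + (r² - 1) n⃗ ⊗ n⃗)` on the mid-plate, for the in-plane
director `n⃗ = (n₁, n₂, 0)`. -/
def nematicField (r δ : ℝ) (n : (Fin 2 → ℝ) → (Fin 2 → ℝ)) (x : Fin 2 → ℝ) :
    Matrix (Fin 3) (Fin 3) ℝ :=
  nematic r δ ![n x 0, n x 1, 0]

/-- The principal `2 × 2` minor `G_{2×2}` of a `3 × 3` matrix. -/
def principal2 (A : Matrix (Fin 3) (Fin 3) ℝ) : Matrix (Fin 2) (Fin 2) ℝ :=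
  A.submatrix Fin.castSucc Fin.castSucc

/-- The planar metric `Id₂ + (r² - 1) n ⊗ n`. -/
def planarField (r : ℝ) (n : (Fin 2 → ℝ) → (Fin 2 → ℝ)) (x : Fin 2 → ℝ) :
    Matrix (Fin 2) (Fin 2) ℝ :=
  1 + (r ^ 2 - 1) • Matrix.vecMulVec (n x) (n x)

/-- The metric `G` on `U ⊆ ℝ³` is immersible: `(∇u)ᵀ ∇u = G` on `U` for some smooth
`u : U → ℝ³`. -/
def Immersible (U : Set (Fin 3 → ℝ)) (G : (Fin 3 → ℝ) → Matrix (Fin 3) (Fin 3) ℝ) : Prop :=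
  ∃ u : (Fin 3 → ℝ) → (Fin 3 → ℝ), ContDiffOn ℝ ∞ u U ∧
    ∀ x ∈ U, (jacobian u x)ᵀ * jacobian u x = G x

end NematicPlate

end

/-! The block h = `G_{2×2}` has constant eigenvalues, hence constant trace T and determinant D. Its
first derivatives are therefore those of a rotating eigenframe: all are multiples of one angular
velocity θ (`exists_angular_velocity`). Substituting this, the terms of `R₁₂₁₂` quadratic in the
Christoffel symbols cancel, leaving `R₁₂₁₂ = -(1/2) curlᵀcurl h` (`riemannCov_eq_curlTcurl`). As h
is a constant multiple of the planar metric, (ii) and (iii) agree. Since G is the product of h with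
a constant vertical metric, `R₁₂₁₂` of G is that of h (`riemannCov_uniformThrough`), so (iv) gives
(iii). A metric induced from Euclidean space of the same dimension is flat
(`riemann_eq_zero_of_jacobian`), so (i) gives (iv).

For (iii) → (i) the immersion is built by two quadratures. The square root of h is explicit: by
Cayley–Hamilton S = (h + ρ)/τ with ρ = √D and τ = tr S. A map v with ∇v = R(φ) S, where R(φ) is the
rotation by φ, has (∇v)ᵀ∇v = S² = h. The rows of R(φ) S are curl-free once dφ equals the connection
form of the coframe S, and the curl of that form is `curlᵀcurl h / (2ρ)`. The Poincaré lemma on the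
simply connected Ω gives first φ, then v (`exists_map_of_curlTcurl_eq_zero`); the immersion is (v₁,
v₂, r^δ x₃). -/

/-! ### Gluing local primitives: the Poincaré lemma on simply connected open sets. -/

open Filter Topology in
/-- On a simply connected space, functions on the members of an open cover that differ by locally
constant functions on the overlaps can be corrected by locally constant functions to a single
global function. -/
theorem exists_forall_eventually_sub_eq {X A : Type*} [TopologicalSpace X]
    [SimplyConnectedSpace X] [LocallyPathConnectedSpace X] [AddCommGroup A]
    (U : X → Set X) (hU : ∀ i, IsOpen (U i)) (hmem : ∀ i, i ∈ U i) (f : X → X → A)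
    (hf : ∀ i j, ∀ x ∈ U i ∩ U j, ∀ᶠ y in 𝓝 x, f i y - f j y = f i x - f j x) :
    ∃ φ : X → A, ∀ i, ∀ x ∈ U i, ∀ᶠ y in 𝓝 x, φ y - f i y = φ x - f i x := by
  let _ : TopologicalSpace A := ⊥
  have _ : DiscreteTopology A := ⟨rfl⟩
  -- The differences `f i - f j` form a locally constant cocycle. They glue the pieces `U i × A`,
  -- with A discrete, into a covering space of X.
  let Z : FiberBundleCore X X A :=
    { baseSet := U
      isOpen_baseSet := hU
      indexAt := id
      mem_baseSet_at := hmem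
      coordChange := fun i j x c => c + (f i x - f j x)
      coordChange_self := by simp
      continuousOn_coordChange := by
        rintro i j ⟨x, c⟩ ⟨hx, -⟩
        refine ContinuousAt.continuousWithinAt ?_
        rw [ContinuousAt, nhds_discrete A, tendsto_pure, nhds_prod_eq, nhds_discrete A]
        filter_upwards [(hf i j x hx).prod_mk (eventually_pure.2 (rfl : c = c))] with p hp
        rw [hp.1, ← hp.2]
      coordChange_comp := by
        intro i j k x _ v
        abel }
  have hcov : IsCoveringMap (Bundle.TotalSpace.proj : Bundle.TotalSpace A Z.Fiber → X) :=
    FiberBundle.isCoveringMap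
  obtain ⟨x₀⟩ : Nonempty X := inferInstance
  -- Simple connectedness enters here: the identity of X lifts to a global section.
  obtain ⟨s, ⟨-, hs⟩, -⟩ := hcov.existsUnique_continuousMap_lifts (ContinuousMap.id X) x₀
    ⟨x₀, (0 : A)⟩ rfl
  have hs' : ∀ x, (s x).proj = x := fun x => congrFun hs x
  let c : X → A := fun x => (s x).2
  -- `c x` is the coordinate of the section in the chart indexed by x itself. In the chart i the
  -- coordinate is `c y + f y y - f i y`, which is locally constant because the fibre is discrete.
  refine ⟨fun x => c x + f x x, fun i x hx => ?_⟩
  have hcoord : ∀ y, ((Z.localTriv i) (s y)).2 = c y + f y y - f i y := by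
    intro y
    rw [Z.localTriv_apply]
    change c y + (f (s y).proj (s y).proj - f i (s y).proj) = _
    rw [hs' y]; abel
  have hsrc : s x ∈ (Z.localTriv i).source := by
    rw [Z.mem_localTriv_source]
    change (s x).proj ∈ U i
    rwa [hs' x]
  have hcont : ContinuousAt (fun y => ((Z.localTriv i) (s y)).2) x :=
    (((Z.localTriv i).continuousAt hsrc).comp s.continuous.continuousAt).snd
  rw [ContinuousAt, nhds_discrete A, tendsto_pure] at hcont
  filter_upwards [hcont] with y hy
  rwa [hcoord, hcoord] at hy

open Filter Topology Set in
/-- **Poincaré lemma**: a closed `1`-form on a simply connected open set has a primitive. -/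
theorem IsSimplyConnected.exists_forall_hasFDerivAt_of_fderiv_symmetric {E F : Type*}
    [NormedAddCommGroup E] [NormedSpace ℝ E] [NormedAddCommGroup F] [NormedSpace ℝ F]
    [CompleteSpace F] {s : Set E} (hs : IsSimplyConnected s) (hso : IsOpen s)
    {η : E → E →L[ℝ] F} (hη : DifferentiableOn ℝ η s)
    (hdη : ∀ a ∈ s, ∀ x y, fderiv ℝ η a x y = fderiv ℝ η a y x) :
    ∃ f, ∀ a ∈ s, HasFDerivAt f (η a) a := by
  have _ : SimplyConnectedSpace s := hs
  have _ : LocallyPathConnectedSpace s := hso.locallyPathConnectedSpace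
  have hball : ∀ i : s, ∃ ε > 0, Metric.ball (i : E) ε ⊆ s :=
    fun i => Metric.isOpen_iff.1 hso i i.2
  choose ε hε hεs using hball
  have hprim : ∀ i : s, ∃ f : E → F, ∀ a ∈ Metric.ball (i : E) (ε i), HasFDerivAt f (η a) a :=
    fun i => (convex_ball (i : E) (ε i)).exists_forall_hasFDerivAt_of_fderiv_symmetric
      Metric.isOpen_ball (hη.mono (hεs i)) fun a ha => hdη a (hεs i ha)
  choose f hf using hprim
  -- Two primitives differ by a constant on the intersection of two balls, which is convex.
  obtain ⟨φ, hφ⟩ := exists_forall_eventually_sub_eq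
    (fun i : s => (Subtype.val ⁻¹' Metric.ball (i : E) (ε i) : Set s))
    (fun i => Metric.isOpen_ball.preimage continuous_subtype_val)
    (fun i => Metric.mem_ball_self (hε i)) (fun i x => f i x) (by
      rintro i j x ⟨hi, hj⟩
      have hV : IsOpen (Metric.ball (i : E) (ε i) ∩ Metric.ball (j : E) (ε j)) :=
        Metric.isOpen_ball.inter Metric.isOpen_ball
      have hd : ∀ y ∈ Metric.ball (i : E) (ε i) ∩ Metric.ball (j : E) (ε j),
          HasFDerivAt (fun z => f i z - f j z) (0 : E →L[ℝ] F) y := fun y hy => by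
        simpa using (hf i y hy.1).fun_sub (hf j y hy.2)
      filter_upwards [continuous_subtype_val.continuousAt.preimage_mem_nhds
        (hV.mem_nhds (x := (x : E)) ⟨hi, hj⟩)] with y hy
      exact ((convex_ball (i : E) (ε i)).inter
        (convex_ball (j : E) (ε j))).is_const_of_fderivWithin_eq_zero (𝕜 := ℝ)
          (fun y hy => (hd y hy).differentiableAt.differentiableWithinAt)
          (fun y hy => by rw [fderivWithin_of_isOpen hV hy, (hd y hy).fderiv]) hy ⟨hi, hj⟩)
  classical
  refine ⟨fun x => if h : x ∈ s then φ ⟨x, h⟩ else 0, fun a ha => ?_⟩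
  have h := hφ ⟨a, ha⟩ ⟨a, ha⟩ (Metric.mem_ball_self (hε _))
  have h' : ∀ᶠ z in 𝓝 a, ∀ hz : z ∈ s,
      φ ⟨z, hz⟩ = f ⟨a, ha⟩ z + (φ ⟨a, ha⟩ - f ⟨a, ha⟩ a) := by
    rw [← hso.isOpenEmbedding_subtypeVal.map_nhds_eq ⟨a, ha⟩, eventually_map]
    filter_upwards [h] with y hy hz
    rw [← hy]; abel
  refine ((hf ⟨a, ha⟩ a (Metric.mem_ball_self (hε _))).add_const
    (φ ⟨a, ha⟩ - f ⟨a, ha⟩ a)).congr_of_eventuallyEq ?_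
  filter_upwards [h', hso.mem_nhds ha] with z hz hzs
  rw [dif_pos hzs, hz hzs]

namespace NematicPlate

open Filter Topology

/-! ### Calculus of partial derivatives, and potentials of curl-free planar fields. -/

section PartialDerivatives

variable {d : ℕ} {U : Set (Fin d → ℝ)} {f g : (Fin d → ℝ) → ℝ} {x : Fin d → ℝ}

theorem pd_congr_of_eventuallyEq (i : Fin d) (h : f =ᶠ[𝓝 x] g) : pd i f x = pd i g x := by
  rw [pd, pd, h.fderiv_eq]

theorem pd_congr_of_isOpen (hU : IsOpen U) (i : Fin d) (h : ∀ y ∈ U, f y = g y) (hx : x ∈ U) :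
    pd i f x = pd i g x :=
  pd_congr_of_eventuallyEq i (by filter_upwards [hU.mem_nhds hx] with y hy using h y hy)

theorem pd_const (i : Fin d) (c : ℝ) (x : Fin d → ℝ) : pd i (fun _ => c) x = 0 := by
  simp [pd]

theorem pd_add (i : Fin d) (hf : DifferentiableAt ℝ f x) (hg : DifferentiableAt ℝ g x) :
    pd i (fun y => f y + g y) x = pd i f x + pd i g x := by
  simp [pd, fderiv_fun_add hf hg]

theorem pd_sub (i : Fin d) (hf : DifferentiableAt ℝ f x) (hg : DifferentiableAt ℝ g x) :
    pd i (fun y => f y - g y) x = pd i f x - pd i g x := by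
  simp [pd, fderiv_fun_sub hf hg]

theorem pd_mul (i : Fin d) (hf : DifferentiableAt ℝ f x) (hg : DifferentiableAt ℝ g x) :
    pd i (fun y => f y * g y) x = pd i f x * g x + f x * pd i g x := by
  simp [pd, fderiv_fun_mul hf hg]; ring

theorem pd_const_mul (i : Fin d) (c : ℝ) (hf : DifferentiableAt ℝ f x) :
    pd i (fun y => c * f y) x = c * pd i f x := by
  rw [pd_mul i (differentiableAt_const c) hf, pd_const]; ring

theorem pd_sum {ι : Type*} (s : Finset ι) {F : ι → (Fin d → ℝ) → ℝ} (i : Fin d)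
    (hF : ∀ a ∈ s, DifferentiableAt ℝ (F a) x) :
    pd i (fun y => ∑ a ∈ s, F a y) x = ∑ a ∈ s, pd i (F a) x := by
  simp [pd, fderiv_fun_sum hF]

theorem pd_sum_mul {ι : Type*} [Fintype ι] {F G : ι → (Fin d → ℝ) → ℝ} (i : Fin d)
    (hF : ∀ a, DifferentiableAt ℝ (F a) x) (hG : ∀ a, DifferentiableAt ℝ (G a) x) :
    pd i (fun y => ∑ a, F a y * G a y) x = ∑ a, (pd i (F a) x * G a x + F a x * pd i (G a) x) := by
  rw [pd_sum _ i fun a _ => (hF a).fun_mul (hG a)]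
  exact Finset.sum_congr rfl fun a _ => pd_mul i (hF a) (hG a)

theorem _root_.ContDiffOn.pd (hf : ContDiffOn ℝ ∞ f U) (hU : IsOpen U) (i : Fin d) :
    ContDiffOn ℝ ∞ (pd i f) U :=
  ((contDiffOn_infty_iff_fderiv_of_isOpen hU).1 hf).2.clm_apply contDiffOn_const

theorem _root_.ContDiffOn.differentiableAt_of_isOpen (hf : ContDiffOn ℝ ∞ f U) (hU : IsOpen U)
    (hx : x ∈ U) : DifferentiableAt ℝ f x :=
  (hf.differentiableOn (by simp)).differentiableAt (hU.mem_nhds hx)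

theorem pd_comm (hf : ContDiffOn ℝ ∞ f U) (hU : IsOpen U) (hx : x ∈ U) (i j : Fin d) :
    pd i (pd j f) x = pd j (pd i f) x := by
  have h := (contDiffOn_infty_iff_fderiv_of_isOpen hU).1 hf
  have h2 : DifferentiableAt ℝ (fderiv ℝ f) x :=
    (h.2.differentiableOn (by simp)).differentiableAt (hU.mem_nhds hx)
  have hsymm := second_derivative_symmetric_of_eventually (𝕜 := ℝ)
    (f := f) (f' := fderiv ℝ f) (x := x) (f'' := fderiv ℝ (fderiv ℝ f) x)
    (by filter_upwards [hU.mem_nhds hx] with y hy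
        exact (hf.differentiableAt_of_isOpen hU hy).hasFDerivAt) h2.hasFDerivAt
    (Pi.single i 1) (Pi.single j 1)
  have e : ∀ k l : Fin d, pd k (pd l f) x
      = fderiv ℝ (fderiv ℝ f) x (Pi.single k 1) (Pi.single l 1) := by
    intro k l
    change fderiv ℝ (fun y => fderiv ℝ f y (Pi.single l 1)) x (Pi.single k 1) = _
    rw [fderiv_clm_apply h2 (differentiableAt_const _)]
    simp
  rw [e, e, hsymm]

end PartialDerivatives

/-- A smooth planar field with vanishing curl on a simply connected open set is a gradient. -/
theorem exists_potential {Ω : Set (Fin 2 → ℝ)} (hΩ : IsOpen Ω) (hΩs : IsSimplyConnected Ω)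
    {v : (Fin 2 → ℝ) → (Fin 2 → ℝ)} (hv : ∀ i, ContDiffOn ℝ ∞ (fun x => v x i) Ω)
    (hcurl : ∀ x ∈ Ω, curl v x = 0) :
    ∃ φ : (Fin 2 → ℝ) → ℝ, ContDiffOn ℝ ∞ φ Ω ∧ ∀ x ∈ Ω, ∀ i, pd i φ x = v x i := by
  let e : Fin 2 → (Fin 2 → ℝ) →L[ℝ] ℝ := fun i => ContinuousLinearMap.proj i
  let η : (Fin 2 → ℝ) → (Fin 2 → ℝ) →L[ℝ] ℝ := fun x => v x 0 • e 0 + v x 1 • e 1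
  have hη : ContDiffOn ℝ ∞ η Ω :=
    ((hv 0).smul contDiffOn_const).add ((hv 1).smul contDiffOn_const)
  have hdη : ∀ a ∈ Ω, ∀ x y, fderiv ℝ η a x y = fderiv ℝ η a y x := by
    intro a ha x y
    have h0 := ((hv 0).differentiableAt_of_isOpen hΩ ha).hasFDerivAt
    have h1 := ((hv 1).differentiableAt_of_isOpen hΩ ha).hasFDerivAt
    have hd : HasFDerivAt η _ a := (h0.smul_const (e 0)).fun_add (h1.smul_const (e 1))
    have hc := hcurl a ha
    simp only [curl, pd] at hc
    have hexp : ∀ (L : (Fin 2 → ℝ) →L[ℝ] ℝ) (z : Fin 2 → ℝ),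
        L z = z 0 * L (Pi.single 0 1) + z 1 * L (Pi.single 1 1) := by
      intro L z
      have hz : z = z 0 • Pi.single 0 1 + z 1 • Pi.single 1 1 := by
        ext k; fin_cases k <;> simp
      conv_lhs => rw [hz]
      simp
    rw [hd.fderiv]
    simp only [add_apply, ContinuousLinearMap.smulRight_apply, smul_eq_mul, e,
      smul_apply, ContinuousLinearMap.proj_apply]
    rw [hexp (fderiv ℝ (fun x => v x 0) a) x, hexp (fderiv ℝ (fun x => v x 0) a) y,
      hexp (fderiv ℝ (fun x => v x 1) a) x, hexp (fderiv ℝ (fun x => v x 1) a) y]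
    -- In the plane the antisymmetric part of the derivative of the form is the curl times the area
    -- form.
    linear_combination (x 0 * y 1 - x 1 * y 0) * hc
  obtain ⟨φ, hφ⟩ := hΩs.exists_forall_hasFDerivAt_of_fderiv_symmetric hΩ
    (hη.differentiableOn (by simp)) hdη
  refine ⟨φ, (contDiffOn_infty_iff_fderiv_of_isOpen hΩ).2
    ⟨fun x hx => (hφ x hx).differentiableAt.differentiableWithinAt,
      hη.congr fun x hx => (hφ x hx).fderiv⟩, fun x hx i => ?_⟩
  rw [pd, (hφ x hx).fderiv]
  fin_cases i <;> simp [η, e]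

/-! ### Curvature through Christoffel symbols of the first kind; flatness of induced metrics. -/

/-- The Christoffel symbols of the first kind. -/
noncomputable def christoffelLow {d : ℕ} (g : (Fin d → ℝ) → Matrix (Fin d) (Fin d) ℝ)
    (m k l : Fin d) (x : Fin d → ℝ) : ℝ :=
  1 / 2 * (pd l (fun y => g y m k) x + pd k (fun y => g y m l) x - pd m (fun y => g y k l) x)

section Curvature

variable {d : ℕ} {U : Set (Fin d → ℝ)} {g : (Fin d → ℝ) → Matrix (Fin d) (Fin d) ℝ}
  {x : Fin d → ℝ}

theorem contDiffOn_det {M : (Fin d → ℝ) → Matrix (Fin d) (Fin d) ℝ}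
    (hM : ∀ i j, ContDiffOn ℝ ∞ (fun x => M x i j) U) :
    ContDiffOn ℝ ∞ (fun x => (M x).det) U := by
  simp only [Matrix.det_apply]
  exact ContDiffOn.sum fun σ _ => (contDiffOn_prod fun i _ => hM (σ i) i).const_smul _

theorem contDiffOn_inv_apply (hg : ∀ i j, ContDiffOn ℝ ∞ (fun x => g x i j) U)
    (hdet : ∀ x ∈ U, (g x).det ≠ 0) (i j : Fin d) :
    ContDiffOn ℝ ∞ (fun x => (g x)⁻¹ i j) U := by
  have hadj : ContDiffOn ℝ ∞ (fun x => (g x).adjugate i j) U := by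
    simp only [Matrix.adjugate_apply]
    refine contDiffOn_det fun k l => ?_
    by_cases hk : k = j
    · subst hk
      simpa using contDiffOn_const
    · simpa [Matrix.updateRow_ne hk] using hg k l
  refine (((contDiffOn_det hg).inv hdet).mul hadj).congr fun x _ => ?_
  simp [Matrix.inv_def]

theorem contDiffOn_christoffelLow (hU : IsOpen U)
    (hg : ∀ i j, ContDiffOn ℝ ∞ (fun x => g x i j) U) (m k l : Fin d) :
    ContDiffOn ℝ ∞ (christoffelLow g m k l) U :=
  contDiffOn_const.mul ((((hg m k).pd hU l).add ((hg m l).pd hU k)).sub ((hg k l).pd hU m))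

theorem christoffel_eq_sum (i k l : Fin d) (x : Fin d → ℝ) :
    christoffel g i k l x = ∑ m, (g x)⁻¹ i m * christoffelLow g m k l x := by
  simp only [christoffel, christoffelLow, Finset.mul_sum]
  exact Finset.sum_congr rfl fun m _ => by ring

theorem contDiffOn_christoffel (hU : IsOpen U) (hg : ∀ i j, ContDiffOn ℝ ∞ (fun x => g x i j) U)
    (hdet : ∀ x ∈ U, (g x).det ≠ 0) (i k l : Fin d) :
    ContDiffOn ℝ ∞ (christoffel g i k l) U :=
  (ContDiffOn.sum fun m _ => (contDiffOn_inv_apply hg hdet i m).mul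
    (contDiffOn_christoffelLow hU hg m k l)).congr fun x _ => christoffel_eq_sum i k l x

theorem sum_mul_christoffel (hdet : (g x).det ≠ 0) (s k l : Fin d) :
    ∑ i, g x s i * christoffel g i k l x = christoffelLow g s k l x := by
  have h : g x *ᵥ ((g x)⁻¹ *ᵥ fun m => christoffelLow g m k l x)
      = fun m => christoffelLow g m k l x := by
    rw [Matrix.mulVec_mulVec, Matrix.mul_nonsing_inv _ (isUnit_iff_ne_zero.2 hdet),
      Matrix.one_mulVec]
  simpa [Matrix.mulVec, dotProduct, christoffel_eq_sum] using congrFun h s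

/-- The covariant Riemann tensor in terms of the Christoffel symbols of the first kind. -/
theorem riemannCov_eq (hU : IsOpen U) (hg : ∀ i j, ContDiffOn ℝ ∞ (fun x => g x i j) U)
    (hsymm : ∀ x i j, g x i j = g x j i) (hdet : ∀ x ∈ U, (g x).det ≠ 0) (hx : x ∈ U)
    (s i j k : Fin d) :
    riemannCov g s i j k x = pd j (christoffelLow g s i k) x - pd k (christoffelLow g s i j) x
      + ∑ m, ∑ p, (g x)⁻¹ m p * (christoffelLow g m s k x * christoffelLow g p i j x
        - christoffelLow g m s j x * christoffelLow g p i k x) := by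
  have hD : ∀ a b, DifferentiableAt ℝ (fun y => g y a b) x :=
    fun a b => (hg a b).differentiableAt_of_isOpen hU hx
  have hΓ : ∀ a b c, DifferentiableAt ℝ (christoffel g a b c) x :=
    fun a b c => (contDiffOn_christoffel hU hg hdet a b c).differentiableAt_of_isOpen hU hx
  -- Differentiating the lowered symbols instead of the raised ones avoids derivatives of the
  -- inverse metric.
  have hpd : ∀ b c e, pd b (christoffelLow g s c e) x
      = ∑ m, (pd b (fun y => g y s m) x * christoffel g m c e x
        + g x s m * pd b (christoffel g m c e) x) := by
    intro b c e
    rw [← pd_congr_of_isOpen hU b (fun y hy => sum_mul_christoffel (hdet y hy) s c e) hx,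
      pd_sum_mul b (F := fun m y => g y s m) (hD s) fun m => hΓ m c e]
  -- Metric compatibility: `∂_b g_sm` is the sum of the two first-kind symbols with leading indices
  -- s and m.
  have hlow : ∀ b m, christoffelLow g s b m x - pd b (fun y => g y s m) x
      = - christoffelLow g m s b x := by
    intro b m
    simp only [christoffelLow, hsymm _ m s, hsymm _ m b]
    ring
  have hquad : ∀ b c e, ∑ m, g x s m * ∑ l, christoffel g m b l x * christoffel g l c e x
      = ∑ l, christoffelLow g s b l x * christoffel g l c e x := by
    intro b c e
    simp only [Finset.mul_sum, ← mul_assoc]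
    rw [Finset.sum_comm]
    simp only [← Finset.sum_mul, sum_mul_christoffel (hdet x hx)]
  have hup : ∀ b c e, ∑ m, christoffelLow g m s b x * christoffel g m c e x
      = ∑ m, ∑ p, (g x)⁻¹ m p * (christoffelLow g m s b x * christoffelLow g p c e x) := by
    intro b c e
    simp only [christoffel_eq_sum, Finset.mul_sum]
    exact Finset.sum_congr rfl fun m _ => Finset.sum_congr rfl fun p _ => by ring
  have hexp : riemannCov g s i j k x
      = ∑ m, g x s m * pd j (christoffel g m i k) x - ∑ m, g x s m * pd k (christoffel g m i j) x
        + ∑ l, christoffelLow g s j l x * christoffel g l i k x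
        - ∑ l, christoffelLow g s k l x * christoffel g l i j x := by
    rw [← hquad, ← hquad]
    simp only [riemannCov, riemann, mul_add, mul_sub, Finset.sum_add_distrib,
      Finset.sum_sub_distrib]
  rw [hexp, hpd, hpd]
  simp only [mul_sub, Finset.sum_sub_distrib]
  rw [← hup, ← hup]
  simp only [← Finset.sum_add_distrib, ← Finset.sum_sub_distrib]
  exact Finset.sum_congr rfl fun m _ => by
    linear_combination christoffel g m i k x * hlow j m - christoffel g m i j x * hlow k m

/-- The metric induced by a smooth map into Euclidean space of the same dimension is flat. -/
theorem riemann_eq_zero_of_jacobian (hU : IsOpen U) {u : (Fin d → ℝ) → (Fin d → ℝ)}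
    (hu : ContDiffOn ℝ ∞ u U) (hug : ∀ x ∈ U, (jacobian u x)ᵀ * jacobian u x = g x)
    (hdet : ∀ x ∈ U, (g x).det ≠ 0) (hx : x ∈ U) (s i j k : Fin d) :
    riemann g s i j k x = 0 := by
  have hua : ∀ a, ContDiffOn ℝ ∞ (fun y => u y a) U := fun a => contDiffOn_pi.1 hu a
  let J : Fin d → Fin d → (Fin d → ℝ) → ℝ := fun a i => pd i fun y => u y a
  have hJ : ∀ a i, ContDiffOn ℝ ∞ (J a i) U := fun a i => (hua a).pd hU i
  have hJd : ∀ a i, ∀ y ∈ U, DifferentiableAt ℝ (J a i) y :=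
    fun a i y hy => (hJ a i).differentiableAt_of_isOpen hU hy
  have hJc : ∀ a i k, ∀ y ∈ U, pd k (J a i) y = pd i (J a k) y :=
    fun a i k y hy => pd_comm (hua a) hU hy k i
  have hgJ : ∀ i j, ∀ y ∈ U, g y i j = ∑ a, J a i y * J a j y := by
    intro i j y hy
    rw [← hug y hy]
    simp [Matrix.mul_apply, jacobian, J]
  have hg : ∀ i j, ContDiffOn ℝ ∞ (fun x => g x i j) U := fun i j =>
    (ContDiffOn.sum fun a _ => (hJ a i).mul (hJ a j)).congr fun y hy => hgJ i j y hy
  have hΓ : ∀ a b c, ∀ y ∈ U, DifferentiableAt ℝ (christoffel g a b c) y :=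
    fun a b c y hy => (contDiffOn_christoffel hU hg hdet a b c).differentiableAt_of_isOpen hU hy
  have hpdg : ∀ k i j, ∀ y ∈ U, pd k (fun z => g z i j) y
      = ∑ a, (pd k (J a i) y * J a j y + J a i y * pd k (J a j) y) := by
    intro k i j y hy
    rw [pd_congr_of_isOpen hU k (hgJ i j) hy,
      pd_sum_mul k (fun a => hJd a i y hy) fun a => hJd a j y hy]
  -- These are the inner products of ∂ₘu with ∂ₖ∂ₗu. Hence (`hsecond`) the symbols `Γⁱₖₗ` are the
  -- coefficients of ∂ₖ∂ₗu in the frame ∂ᵢu.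
  have hlow : ∀ m k l, ∀ y ∈ U, christoffelLow g m k l y = ∑ a, J a m y * pd k (J a l) y := by
    intro m k l y hy
    rw [christoffelLow, hpdg l m k y hy, hpdg k m l y hy, hpdg m k l y hy,
      ← Finset.sum_add_distrib, ← Finset.sum_sub_distrib, Finset.mul_sum]
    refine Finset.sum_congr rfl fun a _ => ?_
    rw [hJc a m l y hy, hJc a k l y hy, hJc a m k y hy]
    ring
  have hmat : ∀ y ∈ U, jacobian u y * ((g y)⁻¹ * (jacobian u y)ᵀ) = 1 := by
    intro y hy
    rw [mul_eq_one_comm, Matrix.mul_assoc, hug y hy,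
      Matrix.nonsing_inv_mul _ (isUnit_iff_ne_zero.2 (hdet y hy))]
  have hsecond : ∀ a k l, ∀ y ∈ U, ∑ i, J a i y * christoffel g i k l y = pd k (J a l) y := by
    intro a k l y hy
    have h : jacobian u y *ᵥ ((g y)⁻¹ *ᵥ ((jacobian u y)ᵀ *ᵥ fun b => pd k (J b l) y))
        = fun b => pd k (J b l) y := by
      rw [Matrix.mulVec_mulVec, Matrix.mulVec_mulVec, Matrix.mul_assoc, hmat y hy, Matrix.one_mulVec]
    have h' := congrFun h a
    simp only [christoffel_eq_sum]
    rw [← h']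
    simp only [Matrix.mulVec, dotProduct]
    refine Finset.sum_congr rfl fun i _ => ?_
    refine congrArg₂ (· * ·) rfl (Finset.sum_congr rfl fun m _ => ?_)
    rw [hlow m k l y hy]
    rfl
  have hthird : ∀ a i j k, ∑ m, J a m x * (pd j (christoffel g m i k) x
      + ∑ l, christoffel g m j l x * christoffel g l i k x) = pd j (pd i (J a k)) x := by
    intro a i j k
    rw [← pd_congr_of_isOpen hU j (hsecond a i k) hx,
      pd_sum_mul j (fun m => hJd a m x hx) fun m => hΓ m i k x hx]
    simp only [mul_add, Finset.sum_add_distrib]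
    have hq : ∑ m, J a m x * ∑ l, christoffel g m j l x * christoffel g l i k x
        = ∑ l, pd j (J a l) x * christoffel g l i k x := by
      simp only [Finset.mul_sum, ← mul_assoc]
      rw [Finset.sum_comm]
      simp only [← Finset.sum_mul, hsecond a _ _ x hx]
    rw [hq, add_comm]
  -- By `hthird`, ∇u applied to the curvature vector is a difference of third derivatives of u taken
  -- in two orders. The Jacobian is invertible, so the curvature vanishes.
  have hker : jacobian u x *ᵥ (fun m => riemann g m i j k x) = 0 := by
    ext a
    have h1 := hthird a i j k
    have h2 := hthird a i k j
    have h3 : pd j (pd i (J a k)) x = pd k (pd i (J a j)) x := by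
      rw [pd_congr_of_isOpen hU j (hJc a k i) hx, pd_congr_of_isOpen hU k (hJc a j i) hx]
      exact pd_comm ((hua a).pd hU i) hU hx j k
    rw [h3, ← h2] at h1
    rw [Matrix.mulVec, dotProduct, Pi.zero_apply, ← sub_eq_zero.2 h1, ← Finset.sum_sub_distrib]
    exact Finset.sum_congr rfl fun m _ => by
      simp only [riemann, jacobian, Matrix.of_apply, J]; ring
  have hz := congrArg (fun v => ((g x)⁻¹ * (jacobian u x)ᵀ) *ᵥ v) hker
  simp only [Matrix.mulVec_mulVec, Matrix.mulVec_zero, mul_eq_one_comm.1 (hmat x hx),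
    Matrix.one_mulVec] at hz
  exact congrFun hz s

end Curvature

/-! ### Planar metrics with constant eigenvalues: linear curvature and construction of the
immersion. -/

section Planar

variable {Ω : Set (Fin 2 → ℝ)} {h : (Fin 2 → ℝ) → Matrix (Fin 2) (Fin 2) ℝ} {T D : ℝ}
  {x : Fin 2 → ℝ}

/-- Along a planar symmetric matrix field with constant eigenvalues, the first derivatives are
those of a rotation of the eigenframe with angular velocity `θ`. -/
theorem exists_angular_velocity (hΩ : IsOpen Ω)
    (hh : ∀ i j, ContDiffOn ℝ ∞ (fun x => h x i j) Ω)
    (htr : ∀ x ∈ Ω, h x 0 0 + h x 1 1 = T) (hdet : ∀ x ∈ Ω, h x 0 0 * h x 1 1 - h x 0 1 ^ 2 = D)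
    (hx : x ∈ Ω) :
    ∃ θ : Fin 2 → ℝ, ∀ i, pd i (fun y => h y 0 0) x = -2 * h x 0 1 * θ i ∧
      pd i (fun y => h y 0 1) x = (h x 0 0 - h x 1 1) * θ i ∧
      pd i (fun y => h y 1 1) x = 2 * h x 0 1 * θ i := by
  have hd : ∀ i j, DifferentiableAt ℝ (fun y => h y i j) x :=
    fun i j => (hh i j).differentiableAt_of_isOpen hΩ hx
  have hdisc : ∀ y ∈ Ω, (h y 0 0 - h y 1 1) ^ 2 + 4 * h y 0 1 ^ 2 = T ^ 2 - 4 * D := fun y hy => by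
    rw [← htr y hy, ← hdet y hy]; ring
  have hpdtr : ∀ i, pd i (fun y => h y 1 1) x = - pd i (fun y => h y 0 0) x := by
    intro i
    have := pd_congr_of_isOpen hΩ i htr hx
    rw [pd_add i (hd 0 0) (hd 1 1), pd_const] at this
    linear_combination this
  -- The vector (h₁₁ - h₂₂, 2h₁₂) stays on the circle of squared radius T² - 4D, so its derivative
  -- is tangent to that circle. The number θ measures this tangential motion.
  have hpddet : ∀ i, (h x 0 0 - h x 1 1) * pd i (fun y => h y 0 0) x
      + 2 * h x 0 1 * pd i (fun y => h y 0 1) x = 0 := by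
    intro i
    have := pd_congr_of_isOpen (f := fun y => h y 0 0 * h y 1 1 - h y 0 1 * h y 0 1) (g := fun _ => D)
      hΩ i (fun y hy => by rw [← hdet y hy]; ring) hx
    rw [pd_sub i ((hd 0 0).fun_mul (hd 1 1)) ((hd 0 1).fun_mul (hd 0 1)), pd_const,
      pd_mul i (hd 0 0) (hd 1 1), pd_mul i (hd 0 1) (hd 0 1), hpdtr] at this
    linear_combination -this
  -- Equal eigenvalues make h a constant multiple of the identity, and θ = 0 serves.
  rcases eq_or_ne (T ^ 2 - 4 * D) 0 with h0 | h0
  · have hzero : ∀ y ∈ Ω, h y 0 0 = T / 2 ∧ h y 0 1 = 0 := by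
      intro y hy
      have h1 := hdisc y hy
      have h2 : h y 0 0 - h y 1 1 = 0 := by
        refine pow_eq_zero_iff two_ne_zero |>.1 ?_
        nlinarith [sq_nonneg (h y 0 0 - h y 1 1), sq_nonneg (h y 0 1)]
      have h3 : h y 0 1 = 0 := by
        refine pow_eq_zero_iff two_ne_zero |>.1 ?_
        nlinarith [sq_nonneg (h y 0 0 - h y 1 1), sq_nonneg (h y 0 1)]
      exact ⟨by linarith [htr y hy], h3⟩
    refine ⟨0, fun i => ?_⟩
    have e0 : pd i (fun y => h y 0 0) x = 0 := by
      rw [pd_congr_of_isOpen hΩ i (fun y hy => (hzero y hy).1) hx, pd_const]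
    have e1 : pd i (fun y => h y 0 1) x = 0 := by
      rw [pd_congr_of_isOpen hΩ i (fun y hy => (hzero y hy).2) hx, pd_const]
    simp [hpdtr, e0, e1]
  · refine ⟨fun i => ((h x 0 0 - h x 1 1) * pd i (fun y => h y 0 1) x
      - 2 * h x 0 1 * pd i (fun y => h y 0 0) x) / (T ^ 2 - 4 * D), fun i => ?_⟩
    have h00 : pd i (fun y => h y 0 0) x = -2 * h x 0 1 * (((h x 0 0 - h x 1 1)
        * pd i (fun y => h y 0 1) x - 2 * h x 0 1 * pd i (fun y => h y 0 0) x)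
          / (T ^ 2 - 4 * D)) := by
      rw [mul_div_assoc', eq_div_iff h0, ← hdisc x hx]
      linear_combination (h x 0 0 - h x 1 1) * hpddet i
    refine ⟨h00, ?_, by rw [hpdtr]; linear_combination -h00⟩
    rw [mul_div_assoc', eq_div_iff h0, ← hdisc x hx]
    linear_combination (2 * h x 0 1) * hpddet i

theorem curlTcurl_eq (h : (Fin 2 → ℝ) → Matrix (Fin 2) (Fin 2) ℝ) (x : Fin 2 → ℝ) :
    curlTcurl h x
      = pd 0 (fun y => pd 0 (fun z => h z 1 1) y - pd 1 (fun z => h z 1 0) y) x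
        - pd 1 (fun y => pd 0 (fun z => h z 0 1) y - pd 1 (fun z => h z 0 0) y) x :=
  rfl

theorem curlTcurl_const_smul (hΩ : IsOpen Ω)
    (hh : ∀ i j, ContDiffOn ℝ ∞ (fun x => h x i j) Ω) (c : ℝ) (hx : x ∈ Ω)
    {k : (Fin 2 → ℝ) → Matrix (Fin 2) (Fin 2) ℝ} (hk : ∀ y i j, k y i j = c * h y i j) :
    curlTcurl k x = c * curlTcurl h x := by
  have hrow : ∀ i, ∀ y ∈ Ω, pd 0 (fun z => k z i 1) y - pd 1 (fun z => k z i 0) y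
      = c * (pd 0 (fun z => h z i 1) y - pd 1 (fun z => h z i 0) y) := by
    intro i y hy
    simp only [hk]
    rw [pd_const_mul 0 c ((hh i 1).differentiableAt_of_isOpen hΩ hy),
      pd_const_mul 1 c ((hh i 0).differentiableAt_of_isOpen hΩ hy)]
    ring
  have hd : ∀ l i j, DifferentiableAt ℝ (pd l (fun z => h z i j)) x :=
    fun l i j => ((hh i j).pd hΩ l).differentiableAt_of_isOpen hΩ hx
  rw [curlTcurl_eq, curlTcurl_eq, pd_congr_of_isOpen hΩ 0 (hrow 1) hx,
    pd_congr_of_isOpen hΩ 1 (hrow 0) hx,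
    pd_const_mul 0 c ((hd 0 1 1).fun_sub (hd 1 1 0)),
    pd_const_mul 1 c ((hd 0 0 1).fun_sub (hd 1 0 0))]
  ring

/-- For a planar metric with constant eigenvalues the curvature is linear in the metric. -/
theorem riemannCov_eq_curlTcurl (hΩ : IsOpen Ω)
    (hh : ∀ i j, ContDiffOn ℝ ∞ (fun x => h x i j) Ω) (hsymm : ∀ x i j, h x i j = h x j i)
    (htr : ∀ x ∈ Ω, h x 0 0 + h x 1 1 = T) (hdet : ∀ x ∈ Ω, h x 0 0 * h x 1 1 - h x 0 1 ^ 2 = D)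
    (hD : D ≠ 0) (hx : x ∈ Ω) :
    riemannCov h 0 1 0 1 x = -(1 / 2) * curlTcurl h x := by
  have hdet' : ∀ y ∈ Ω, (h y).det = D := fun y hy => by
    rw [Matrix.det_fin_two, ← hdet y hy, hsymm y 1 0]; ring
  have hs : (fun y => h y 1 0) = fun y => h y 0 1 := funext fun y => hsymm y 1 0
  have hd : ∀ l i j, DifferentiableAt ℝ (pd l (fun z => h z i j)) x :=
    fun l i j => ((hh i j).pd hΩ l).differentiableAt_of_isOpen hΩ hx
  obtain ⟨θ, hθ⟩ := exists_angular_velocity hΩ hh htr hdet hx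
  have hlin : pd 0 (christoffelLow h 0 1 1) x - pd 1 (christoffelLow h 0 1 0) x
      = -(1 / 2) * curlTcurl h x := by
    unfold christoffelLow
    rw [curlTcurl_eq, hs, pd_const_mul 0 _ (((hd 1 0 1).fun_add (hd 1 0 1)).fun_sub (hd 0 1 1)),
      pd_const_mul 1 _ (((hd 0 0 1).fun_add (hd 1 0 0)).fun_sub (hd 0 0 1)),
      pd_sub 0 ((hd 1 0 1).fun_add (hd 1 0 1)) (hd 0 1 1), pd_add 0 (hd 1 0 1) (hd 1 0 1),
      pd_sub 1 ((hd 0 0 1).fun_add (hd 1 0 0)) (hd 0 0 1), pd_add 1 (hd 0 0 1) (hd 1 0 0),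
      pd_sub 0 (hd 0 1 1) (hd 1 0 1), pd_sub 1 (hd 0 0 1) (hd 1 0 0),
      pd_comm (hh 0 1) hΩ hx 0 1]
    ring
  -- With every first derivative of h written through θ, this becomes a polynomial identity.
  have hquad : ∑ m, ∑ p, (h x)⁻¹ m p * (christoffelLow h m 0 1 x * christoffelLow h p 1 0 x
      - christoffelLow h m 0 0 x * christoffelLow h p 1 1 x) = 0 := by
    have hinv : (h x)⁻¹ = D⁻¹ • !![h x 1 1, -h x 0 1; -h x 0 1, h x 0 0] := by
      rw [Matrix.inv_def, hdet' x hx, Ring.inverse_eq_inv', Matrix.adjugate_fin_two, hsymm x 1 0]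
    simp only [Fin.sum_univ_two, hinv, Matrix.smul_apply, Matrix.of_apply, Matrix.cons_val',
      Matrix.cons_val_zero, Matrix.cons_val_one, Matrix.cons_val_fin_one, smul_eq_mul,
      christoffelLow, hs, (hθ _).1, (hθ _).2.1, (hθ _).2.2]
    ring
  rw [riemannCov_eq hΩ hh hsymm (fun y hy => by rwa [hdet' y hy]) hx, hlin, hquad, add_zero]

theorem pd_cos {d : ℕ} {f : (Fin d → ℝ) → ℝ} {x : Fin d → ℝ} (i : Fin d)
    (hf : DifferentiableAt ℝ f x) :
    pd i (fun y => Real.cos (f y)) x = -Real.sin (f x) * pd i f x := by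
  rw [pd, hf.hasFDerivAt.cos.fderiv]; rfl

theorem pd_sin {d : ℕ} {f : (Fin d → ℝ) → ℝ} {x : Fin d → ℝ} (i : Fin d)
    (hf : DifferentiableAt ℝ f x) :
    pd i (fun y => Real.sin (f y)) x = Real.cos (f x) * pd i f x := by
  rw [pd, hf.hasFDerivAt.sin.fderiv]; rfl

/-- A symmetric coframe `(a, b), (b, e)` satisfying the structure equations with connection form
`dφ` is, after rotation by `φ`, the differential of a planar map. -/
theorem exists_map_of_structure_equations (hΩ : IsOpen Ω) (hΩs : IsSimplyConnected Ω)
    {a b e φ : (Fin 2 → ℝ) → ℝ} (ha : ContDiffOn ℝ ∞ a Ω) (hb : ContDiffOn ℝ ∞ b Ω)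
    (he : ContDiffOn ℝ ∞ e Ω) (hφ : ContDiffOn ℝ ∞ φ Ω)
    (h0 : ∀ x ∈ Ω, pd 0 φ x * e x - pd 1 φ x * b x = pd 0 b x - pd 1 a x)
    (h1 : ∀ x ∈ Ω, pd 0 φ x * b x - pd 1 φ x * a x = -(pd 0 e x - pd 1 b x)) :
    ∃ v : Fin 2 → (Fin 2 → ℝ) → ℝ, (∀ k, ContDiffOn ℝ ∞ (v k) Ω) ∧ ∀ x ∈ Ω,
      ∀ i j, ∑ k, pd i (v k) x * pd j (v k) x = (!![a x, b x; b x, e x] ^ 2) i j := by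
  have hc : ContDiffOn ℝ ∞ (fun y => Real.cos (φ y)) Ω := hφ.cos
  have hs : ContDiffOn ℝ ∞ (fun y => Real.sin (φ y)) Ω := hφ.sin
  have hF : ∀ x ∈ Ω, ∀ f : (Fin 2 → ℝ) → ℝ, ContDiffOn ℝ ∞ f Ω → DifferentiableAt ℝ f x :=
    fun x hx f hf => hf.differentiableAt_of_isOpen hΩ hx
  obtain ⟨v, hv, hv'⟩ := exists_potential hΩ hΩs (v := fun x =>
      ![Real.cos (φ x) * a x - Real.sin (φ x) * b x, Real.cos (φ x) * b x - Real.sin (φ x) * e x])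
    (by
      intro i
      fin_cases i
      · exact (hc.mul ha).sub (hs.mul hb)
      · exact (hc.mul hb).sub (hs.mul he))
    (by
      intro x hx
      have hcx := hF x hx _ hc
      have hsx := hF x hx _ hs
      have hax := hF x hx _ ha
      have hbx := hF x hx _ hb
      have hex := hF x hx _ he
      have hφx := hF x hx _ hφ
      simp only [curl, Matrix.cons_val_zero, Matrix.cons_val_one, Matrix.cons_val_fin_one]
      rw [pd_sub 0 (hcx.fun_mul hbx) (hsx.fun_mul hex), pd_sub 1 (hcx.fun_mul hax) (hsx.fun_mul hbx),
        pd_mul 0 hcx hbx, pd_mul 0 hsx hex, pd_mul 1 hcx hax, pd_mul 1 hsx hbx,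
        pd_cos 0 hφx, pd_cos 1 hφx, pd_sin 0 hφx, pd_sin 1 hφx]
      linear_combination -Real.cos (φ x) * h0 x hx - Real.sin (φ x) * h1 x hx)
  obtain ⟨w, hw, hw'⟩ := exists_potential hΩ hΩs (v := fun x =>
      ![Real.sin (φ x) * a x + Real.cos (φ x) * b x, Real.sin (φ x) * b x + Real.cos (φ x) * e x])
    (by
      intro i
      fin_cases i
      · exact (hs.mul ha).add (hc.mul hb)
      · exact (hs.mul hb).add (hc.mul he))
    (by
      intro x hx
      have hcx := hF x hx _ hc
      have hsx := hF x hx _ hs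
      have hax := hF x hx _ ha
      have hbx := hF x hx _ hb
      have hex := hF x hx _ he
      have hφx := hF x hx _ hφ
      simp only [curl, Matrix.cons_val_zero, Matrix.cons_val_one, Matrix.cons_val_fin_one]
      rw [pd_add 0 (hsx.fun_mul hbx) (hcx.fun_mul hex), pd_add 1 (hsx.fun_mul hax) (hcx.fun_mul hbx),
        pd_mul 0 hcx hex, pd_mul 0 hsx hbx, pd_mul 1 hcx hbx, pd_mul 1 hsx hax,
        pd_cos 0 hφx, pd_cos 1 hφx, pd_sin 0 hφx, pd_sin 1 hφx]
      linear_combination -Real.sin (φ x) * h0 x hx + Real.cos (φ x) * h1 x hx)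
  refine ⟨![v, w], fun k => by fin_cases k <;> assumption, fun x hx i j => ?_⟩
  -- The gradients are the rows of R(φ) S with S symmetric, so their Gram matrix is S R(φ)ᵀ R(φ) S =
  -- S².
  have hcs := Real.sin_sq_add_cos_sq (φ x)
  rw [Fin.sum_univ_two, pow_two, Matrix.mul_apply, Fin.sum_univ_two]
  simp only [Matrix.cons_val_zero, Matrix.cons_val_one, Matrix.cons_val_fin_one,
    hv' x hx, hw' x hx]
  fin_cases i <;> fin_cases j <;> simp
  · linear_combination (a x ^ 2 + b x ^ 2) * hcs
  · linear_combination (a x * b x + b x * e x) * hcs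
  · linear_combination (a x * b x + b x * e x) * hcs
  · linear_combination (b x ^ 2 + e x ^ 2) * hcs

/-- A planar metric with constant eigenvalues whose `curlᵀ curl` vanishes is induced by a planar
map. -/
theorem exists_map_of_curlTcurl_eq_zero (hΩ : IsOpen Ω) (hΩs : IsSimplyConnected Ω)
    (hh : ∀ i j, ContDiffOn ℝ ∞ (fun x => h x i j) Ω) (hsymm : ∀ x i j, h x i j = h x j i)
    {ρ τ : ℝ} (hρ : ρ ≠ 0) (hτ : τ ≠ 0)
    (htr : ∀ x ∈ Ω, h x 0 0 + h x 1 1 = τ ^ 2 - 2 * ρ)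
    (hdet : ∀ x ∈ Ω, h x 0 0 * h x 1 1 - h x 0 1 ^ 2 = ρ ^ 2)
    (hcurl : ∀ x ∈ Ω, curlTcurl h x = 0) :
    ∃ v : Fin 2 → (Fin 2 → ℝ) → ℝ, (∀ k, ContDiffOn ℝ ∞ (v k) Ω) ∧ ∀ x ∈ Ω,
      ∀ i j, ∑ k, pd i (v k) x * pd j (v k) x = h x i j := by
  let p := fun y => h y 0 0
  let q := fun y => h y 0 1
  let s := fun y => h y 1 1
  have hp : ContDiffOn ℝ ∞ p Ω := hh 0 0
  have hq : ContDiffOn ℝ ∞ q Ω := hh 0 1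
  have hs : ContDiffOn ℝ ∞ s Ω := hh 1 1
  have hs10 : (fun y => h y 1 0) = q := funext fun y => hsymm y 1 0
  have hF : ∀ x ∈ Ω, ∀ f : (Fin 2 → ℝ) → ℝ, ContDiffOn ℝ ∞ f Ω → DifferentiableAt ℝ f x :=
    fun x hx f hf => hf.differentiableAt_of_isOpen hΩ hx
  let K₀ := fun y => pd 0 q y - pd 1 p y
  let K₁ := fun y => pd 0 s y - pd 1 q y
  have hK₀ : ContDiffOn ℝ ∞ K₀ Ω := (hq.pd hΩ 0).sub (hp.pd hΩ 1)
  have hK₁ : ContDiffOn ℝ ∞ K₁ Ω := (hs.pd hΩ 0).sub (hq.pd hΩ 1)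
  -- This is (T² - 4D) θ with T² - 4D = τ²(τ² - 4ρ). Unlike θ, which is only chosen pointwise, it is
  -- visibly smooth, also when the eigenvalues coincide.
  let w : Fin 2 → (Fin 2 → ℝ) → ℝ := fun i y => (p y - s y) * pd i q y - 2 * q y * pd i p y
  have hw : ∀ i, ContDiffOn ℝ ∞ (w i) Ω := fun i =>
    ((hp.sub hs).mul (hq.pd hΩ i)).sub ((contDiffOn_const.mul hq).mul (hp.pd hΩ i))
  -- The field is the solution dφ of the structure equations for (h + ρ)/τ. The curl of K is
  -- `curlᵀcurl h`. That of w vanishes: second derivatives commute, and the first-derivative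
  -- products cancel because all gradients are parallel to θ.
  obtain ⟨φ, hφ, hφ'⟩ := exists_potential hΩ hΩs (v := fun x =>
      ![1 / (2 * ρ) * K₀ x + 1 / (2 * ρ * τ ^ 2) * w 0 x,
        1 / (2 * ρ) * K₁ x + 1 / (2 * ρ * τ ^ 2) * w 1 x])
    (by
      intro i
      fin_cases i
      · exact (contDiffOn_const.mul hK₀).add (contDiffOn_const.mul (hw 0))
      · exact (contDiffOn_const.mul hK₁).add (contDiffOn_const.mul (hw 1)))
    (by
      intro x hx
      obtain ⟨θ, hθ⟩ := exists_angular_velocity hΩ hh htr hdet hx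
      have hK : pd 0 K₁ x - pd 1 K₀ x = 0 := by
        have := hcurl x hx
        rwa [curlTcurl_eq, hs10] at this
      have hpx := hF x hx _ hp
      have hqx := hF x hx _ hq
      have hsx := hF x hx _ hs
      have hpw : ∀ i j, pd j (w i) x = (pd j p x - pd j s x) * pd i q x
          + (p x - s x) * pd j (pd i q) x
          - (2 * pd j q x * pd i p x + 2 * q x * pd j (pd i p) x) := by
        intro i j
        have hqi := hF x hx _ (hq.pd hΩ i)
        have hpi := hF x hx _ (hp.pd hΩ i)
        rw [pd_sub j ((hpx.fun_sub hsx).fun_mul hqi) ((hqx.const_mul 2).fun_mul hpi),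
          pd_mul j (hpx.fun_sub hsx) hqi, pd_mul j (hqx.const_mul 2) hpi, pd_sub j hpx hsx,
          pd_const_mul j 2 hqx]
      have hw' : pd 0 (w 1) x - pd 1 (w 0) x = 0 := by
        rw [hpw, hpw, pd_comm hq hΩ hx 0 1, pd_comm hp hΩ hx 0 1]
        simp only [p, q, s, (hθ _).1, (hθ _).2.1, (hθ _).2.2]
        ring
      simp only [curl, Matrix.cons_val_zero, Matrix.cons_val_one, Matrix.cons_val_fin_one]
      have hK₀x := hF x hx _ hK₀
      have hK₁x := hF x hx _ hK₁
      have hwx := fun i => hF x hx _ (hw i)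
      rw [pd_add 0 (hK₁x.const_mul _) ((hwx 1).const_mul _),
        pd_add 1 (hK₀x.const_mul _) ((hwx 0).const_mul _), pd_const_mul 0 _ hK₁x,
        pd_const_mul 1 _ hK₀x, pd_const_mul 0 _ (hwx 1), pd_const_mul 1 _ (hwx 0)]
      linear_combination 1 / (2 * ρ) * hK + 1 / (2 * ρ * τ ^ 2) * hw')
  have hroot : ∀ f : (Fin 2 → ℝ) → ℝ, ContDiffOn ℝ ∞ f Ω → ∀ c : ℝ,
      ContDiffOn ℝ ∞ (fun y => τ⁻¹ * (f y + c)) Ω ∧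
        ∀ i, ∀ x ∈ Ω, pd i (fun y => τ⁻¹ * (f y + c)) x = τ⁻¹ * pd i f x := by
    intro f hf c
    refine ⟨contDiffOn_const.mul (hf.add contDiffOn_const), fun i x hx => ?_⟩
    have hfx := hF x hx _ hf
    rw [pd_const_mul i _ (hfx.add_const c), pd_add i hfx (differentiableAt_const c), pd_const,
      add_zero]
  have hconn : ∀ x ∈ Ω, ∃ θ : Fin 2 → ℝ, (∀ i, pd i p x = -2 * q x * θ i ∧
      pd i q x = (p x - s x) * θ i ∧ pd i s x = 2 * q x * θ i) ∧
      2 * ρ * pd 0 φ x = (p x - s x) * θ 0 + 2 * q x * θ 1 + (τ ^ 2 - 4 * ρ) * θ 0 ∧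
      2 * ρ * pd 1 φ x = 2 * q x * θ 0 - (p x - s x) * θ 1 + (τ ^ 2 - 4 * ρ) * θ 1 := by
    intro x hx
    obtain ⟨θ, hθ⟩ := exists_angular_velocity hΩ hh htr hdet hx
    have hw' : ∀ i, w i x = τ ^ 2 * (τ ^ 2 - 4 * ρ) * θ i := by
      intro i
      have h1 : p x + s x = τ ^ 2 - 2 * ρ := htr x hx
      have h2 : p x * s x - q x ^ 2 = ρ ^ 2 := hdet x hx
      have h3 : pd i p x = -2 * q x * θ i := (hθ i).1
      have h4 : pd i q x = (p x - s x) * θ i := (hθ i).2.1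
      simp only [w, h3, h4]
      linear_combination θ i * ((p x + s x + τ ^ 2 - 2 * ρ) * h1 - 4 * h2)
    refine ⟨θ, hθ, ?_, ?_⟩
    · rw [hφ' x hx 0]
      simp only [Matrix.cons_val_zero, hw', K₀]
      have h3 : pd 1 p x = -2 * q x * θ 1 := (hθ 1).1
      have h4 : pd 0 q x = (p x - s x) * θ 0 := (hθ 0).2.1
      rw [h3, h4]
      field_simp
      ring
    · rw [hφ' x hx 1]
      simp only [Matrix.cons_val_one, Matrix.cons_val_fin_one, hw', K₁]
      have h3 : pd 0 s x = 2 * q x * θ 0 := (hθ 0).2.2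
      have h4 : pd 1 q x = (p x - s x) * θ 1 := (hθ 1).2.1
      rw [h3, h4]
      field_simp
  obtain ⟨v, hv, hv'⟩ := exists_map_of_structure_equations hΩ hΩs
    (hroot p hp ρ).1 (hroot q hq 0).1 (hroot s hs ρ).1 hφ
    (by
      intro x hx
      obtain ⟨θ, hθ, h0, h1⟩ := hconn x hx
      have htx : p x + s x = τ ^ 2 - 2 * ρ := htr x hx
      have hdx : p x * s x - q x ^ 2 = ρ ^ 2 := hdet x hx
      rw [(hroot q hq 0).2 0 x hx, (hroot p hp ρ).2 1 x hx, (hθ 0).2.1, (hθ 1).1]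
      refine mul_left_cancel₀ (mul_ne_zero two_ne_zero hρ) ?_
      linear_combination τ⁻¹ * ((s x + ρ) * h0 - q x * h1 + 2 * θ 0 * hdx
        - ((s x + ρ) * θ 0 - q x * θ 1) * htx))
    (by
      intro x hx
      obtain ⟨θ, hθ, h0, h1⟩ := hconn x hx
      have htx : p x + s x = τ ^ 2 - 2 * ρ := htr x hx
      have hdx : p x * s x - q x ^ 2 = ρ ^ 2 := hdet x hx
      rw [(hroot s hs ρ).2 0 x hx, (hroot q hq 0).2 1 x hx, (hθ 0).2.2, (hθ 1).2.1]
      refine mul_left_cancel₀ (mul_ne_zero two_ne_zero hρ) ?_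
      linear_combination τ⁻¹ * (q x * h0 - (p x + ρ) * h1 - 2 * θ 1 * hdx
        - (q x * θ 0 - (p x + ρ) * θ 1) * htx))
  -- Cayley–Hamilton: (h + ρ)² = (T + 2ρ) h = τ² h.
  refine ⟨v, hv, fun x hx i j => ?_⟩
  rw [hv' x hx i j, pow_two, Matrix.mul_apply, Fin.sum_univ_two]
  have htx : p x + s x = τ ^ 2 - 2 * ρ := htr x hx
  have hdx : p x * s x - q x ^ 2 = ρ ^ 2 := hdet x hx
  have hcancel : τ⁻¹ * τ = 1 := inv_mul_cancel₀ hτ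
  fin_cases i <;> fin_cases j <;> simp
  · change _ = p x
    field_simp
    linear_combination p x * htx - hdx
  · change _ = q x
    field_simp
    linear_combination q x * htx
  · rw [hsymm x 1 0]
    change _ = q x
    field_simp
    linear_combination q x * htx
  · change _ = s x
    field_simp
    linear_combination s x * htx - hdx

end Planar

/-! ### Passing between the mid-plate and the plate. -/

section UniformThrough

/-- The projection `(x', x₃) ↦ x'` onto the mid-plate. -/
noncomputable def midProj : (Fin 3 → ℝ) →L[ℝ] (Fin 2 → ℝ) :=
  ContinuousLinearMap.pi fun i => ContinuousLinearMap.proj i.castSucc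

theorem midProj_apply (x : Fin 3 → ℝ) : midProj x = ![x 0, x 1] := by
  ext i; fin_cases i <;> rfl

theorem uniformThrough_eq {α : Type*} (F : (Fin 2 → ℝ) → α) (x : Fin 3 → ℝ) :
    uniformThrough F x = F (midProj x) := by
  rw [uniformThrough, midProj_apply]

variable {f : (Fin 2 → ℝ) → ℝ} {x : Fin 3 → ℝ}

theorem pd_castSucc_comp_midProj (i : Fin 2) (hf : DifferentiableAt ℝ f (midProj x)) :
    pd i.castSucc (fun y => f (midProj y)) x = pd i f (midProj x) := by
  rw [pd, ((hf.hasFDerivAt.comp x midProj.hasFDerivAt).congr_of_eventuallyEq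
    (f₁ := fun y => f (midProj y)) .rfl).fderiv]
  change fderiv ℝ f (midProj x) (midProj (Pi.single i.castSucc 1)) = _
  congr 1
  ext j
  fin_cases i <;> fin_cases j <;> simp [midProj]

theorem pd_last_comp_midProj (hf : DifferentiableAt ℝ f (midProj x)) :
    pd 2 (fun y => f (midProj y)) x = 0 := by
  rw [pd, ((hf.hasFDerivAt.comp x midProj.hasFDerivAt).congr_of_eventuallyEq
    (f₁ := fun y => f (midProj y)) .rfl).fderiv]
  change fderiv ℝ f (midProj x) (midProj (Pi.single 2 1)) = _
  have : midProj (Pi.single 2 1) = 0 := by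
    ext j
    fin_cases j <;> simp [midProj]
  rw [this, map_zero]

/-- The zeros in the bottom row of A remove the third summand from the planar entries of A⁻¹A. -/
theorem principal2_inv {A : Matrix (Fin 3) (Fin 3) ℝ} (hdet : A.det ≠ 0)
    (hA : ∀ j : Fin 2, A 2 j.castSucc = 0) : (principal2 A)⁻¹ = principal2 A⁻¹ := by
  refine Matrix.inv_eq_left_inv ?_
  ext i j
  have h := congrFun (congrFun (Matrix.nonsing_inv_mul A (isUnit_iff_ne_zero.2 hdet)) i.castSucc)
    j.castSucc
  rw [Matrix.mul_apply, Fin.sum_univ_castSucc] at h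
  rw [Matrix.mul_apply]
  have h2 : A (Fin.last 2) j.castSucc = 0 := hA j
  rw [h2, mul_zero, add_zero] at h
  refine h.trans ?_
  simp [Matrix.one_apply]

variable {Ω : Set (Fin 2 → ℝ)} {F : (Fin 2 → ℝ) → Matrix (Fin 3) (Fin 3) ℝ}

/-- The planar components of the curvature of a metric on the plate that is uniform through the
thickness and splits off the vertical direction are those of the planar metric. -/
theorem riemannCov_uniformThrough (hΩ : IsOpen Ω)
    (hF : ∀ i j, ContDiffOn ℝ ∞ (fun x => F x i j) Ω) (hsymm : ∀ x i j, F x i j = F x j i)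
    (hF2 : ∀ x, ∀ j : Fin 2, F x 2 j.castSucc = 0) (hdet : ∀ x ∈ Ω, (F x).det ≠ 0)
    (hdet2 : ∀ x ∈ Ω, (principal2 (F x)).det ≠ 0) (hx : midProj x ∈ Ω) (s i j k : Fin 2) :
    riemannCov (uniformThrough F) s.castSucc i.castSucc j.castSucc k.castSucc x
      = riemannCov (fun y => principal2 (F y)) s i j k (midProj x) := by
  have hU : IsOpen (midProj ⁻¹' Ω) := hΩ.preimage midProj.continuous
  have hG : ∀ i j, ContDiffOn ℝ ∞ (fun x => uniformThrough F x i j) (midProj ⁻¹' Ω) := by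
    intro i j
    simp only [uniformThrough_eq]
    exact (hF i j).comp midProj.contDiff.contDiffOn fun _ h => h
  have hg : ∀ i j, ContDiffOn ℝ ∞ (fun x => principal2 (F x) i j) Ω :=
    fun i j => hF i.castSucc j.castSucc
  have hFd : ∀ y ∈ midProj ⁻¹' Ω, ∀ i j, DifferentiableAt ℝ (fun x => F x i j) (midProj y) :=
    fun y hy i j => (hF i j).differentiableAt_of_isOpen hΩ hy
  have hpd : ∀ y ∈ midProj ⁻¹' Ω, ∀ l : Fin 2, ∀ i j,
      pd l.castSucc (fun z => uniformThrough F z i j) y = pd l (fun z => F z i j) (midProj y) := by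
    intro y hy l i j
    simp only [uniformThrough_eq]
    exact pd_castSucc_comp_midProj l (hFd y hy i j)
  have hlow : ∀ y ∈ midProj ⁻¹' Ω, ∀ m k l : Fin 2,
      christoffelLow (uniformThrough F) m.castSucc k.castSucc l.castSucc y
        = christoffelLow (fun y => principal2 (F y)) m k l (midProj y) := by
    intro y hy m k l
    simp only [christoffelLow, hpd y hy]
    rfl
  -- The vertical index drops out of the quadratic terms: G has no mixed entries and does not depend
  -- on x₃.
  have hlast : ∀ k l : Fin 2,
      christoffelLow (uniformThrough F) (Fin.last 2) k.castSucc l.castSucc x = 0 := by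
    intro k l
    have h2 : ∀ j : Fin 2, (fun y => F y (Fin.last 2) j.castSucc) = fun _ => 0 :=
      fun j => funext fun y => hF2 y j
    have h3 : pd (Fin.last 2) (fun z => uniformThrough F z k.castSucc l.castSucc) x = 0 := by
      simp only [uniformThrough_eq]
      exact pd_last_comp_midProj (hFd x hx _ _)
    rw [christoffelLow, hpd x hx, hpd x hx, h3, h2, h2, pd_const, pd_const]
    norm_num
  have hpdlow : ∀ j m k l : Fin 2, pd j.castSucc
      (christoffelLow (uniformThrough F) m.castSucc k.castSucc l.castSucc) x
        = pd j (christoffelLow (fun y => principal2 (F y)) m k l) (midProj x) := by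
    intro j m k l
    rw [pd_congr_of_isOpen hU _ (fun y hy => hlow y hy m k l) hx]
    exact pd_castSucc_comp_midProj j
      ((contDiffOn_christoffelLow hΩ hg m k l).differentiableAt_of_isOpen hΩ hx)
  have hinv : ∀ m p : Fin 2, (uniformThrough F x)⁻¹ m.castSucc p.castSucc
      = (principal2 (F (midProj x)))⁻¹ m p := by
    intro m p
    rw [uniformThrough_eq, principal2_inv (hdet _ hx) (hF2 _)]
    rfl
  rw [riemannCov_eq hU hG (fun y => hsymm _) (fun y hy => by
      rw [uniformThrough_eq]; exact hdet _ hy) hx,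
    riemannCov_eq hΩ hg (fun y i j => hsymm y _ _) hdet2 hx]
  simp only [Fin.sum_univ_castSucc (n := 2), hpdlow, hlow x hx, hlast, hinv, mul_zero, zero_mul,
    sub_zero, add_zero, Finset.sum_const_zero]

theorem isOpen_plate (hΩ : IsOpen Ω) (t : ℝ) : IsOpen (plate Ω t) := by
  have h : plate Ω t = midProj ⁻¹' Ω ∩ {x | |x 2| < t / 2} := by
    ext x
    simp [plate, midProj_apply]
  rw [h]
  exact (hΩ.preimage midProj.continuous).inter
    (isOpen_lt (continuous_abs.comp (continuous_apply 2)) continuous_const)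

/-- A planar immersion of `F_{2×2}` extends to an immersion of the plate if `F` splits off the
vertical direction with constant factor `c ^ 2`. -/
theorem immersible_uniformThrough (hΩ : IsOpen Ω) (t c : ℝ) (hsymm : ∀ x i j, F x i j = F x j i)
    (hF2 : ∀ x, ∀ j : Fin 2, F x 2 j.castSucc = 0) (hF22 : ∀ x, F x 2 2 = c ^ 2)
    {v : Fin 2 → (Fin 2 → ℝ) → ℝ} (hv : ∀ k, ContDiffOn ℝ ∞ (v k) Ω)
    (hvF : ∀ x ∈ Ω, ∀ i j, ∑ k, pd i (v k) x * pd j (v k) x = principal2 (F x) i j) :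
    Immersible (plate Ω t) (uniformThrough F) := by
  have hmaps : ∀ y ∈ plate Ω t, midProj y ∈ Ω := fun y hy => by
    rw [midProj_apply]; exact hy.1
  have hvs : ∀ k, ContDiffOn ℝ ∞ (fun y => v k (midProj y)) (plate Ω t) :=
    fun k => (hv k).comp midProj.contDiff.contDiffOn hmaps
  refine ⟨fun y => Fin.snoc (fun k => v k (midProj y)) (c * y 2), ?_, fun x hx => ?_⟩
  · refine contDiffOn_pi.2 fun a => ?_
    refine Fin.lastCases ?_ (fun k => ?_) a
    · simp only [Fin.snoc_last]
      exact contDiffOn_const.mul (contDiff_apply ℝ ℝ (2 : Fin 3)).contDiffOn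
    · simp only [Fin.snoc_castSucc]
      exact hvs k
  have hvd : ∀ k, DifferentiableAt ℝ (v k) (midProj x) :=
    fun k => (hv k).differentiableAt_of_isOpen hΩ (hmaps x hx)
  have hvert : ∀ j : Fin 3, pd j (fun y : Fin 3 → ℝ => c * y 2) x = c * (Pi.single j 1 : Fin 3 → ℝ) 2 := by
    intro j
    rw [pd_const_mul j c (differentiableAt_apply 2 x)]
    congr 1
    rw [pd, (hasFDerivAt_apply (2 : Fin 3) x).fderiv]
    rfl
  have hlast2 : ∀ k, pd (Fin.last 2) (fun y => v k (midProj y)) x = 0 :=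
    fun k => pd_last_comp_midProj (hvd k)
  have hv2 : ∀ j : Fin 2, (Pi.single j.castSucc 1 : Fin 3 → ℝ) 2 = 0 := fun j =>
    Pi.single_eq_of_ne (Fin.castSucc_ne_last j).symm _
  have hl2 : (Pi.single (Fin.last 2) 1 : Fin 3 → ℝ) 2 = 1 := Pi.single_eq_same _ _
  have hF2' : ∀ j : Fin 2, F (midProj x) (Fin.last 2) j.castSucc = 0 := hF2 _
  have hF22' : F (midProj x) (Fin.last 2) (Fin.last 2) = c ^ 2 := hF22 _
  ext i j
  rw [Matrix.mul_apply, Fin.sum_univ_castSucc, uniformThrough_eq]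
  simp only [Matrix.transpose_apply, jacobian, Matrix.of_apply, Fin.snoc_last, Fin.snoc_castSucc,
    hvert]
  refine Fin.lastCases ?_ (fun i => ?_) i <;> refine Fin.lastCases ?_ (fun j => ?_) j
  · simp only [hlast2, hl2, hF22']
    simp
    ring
  · simp only [hlast2, hl2, hv2, hF2']
    simp
  · simp only [hlast2, hl2, hv2, hsymm _ _ (Fin.last 2), hF2']
    simp
  · simp only [hv2, pd_castSucc_comp_midProj _ (hvd _), hvF _ (hmaps x hx)]
    simp [principal2]

end UniformThrough

/-! ### Algebra of the nematic metric, and the equivalence. -/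

section Nematic

variable {r δ : ℝ} {n : (Fin 2 → ℝ) → (Fin 2 → ℝ)}

theorem nematicField_symm (r δ : ℝ) (n : (Fin 2 → ℝ) → (Fin 2 → ℝ)) (x : Fin 2 → ℝ)
    (i j : Fin 3) : nematicField r δ n x i j = nematicField r δ n x j i := by
  simp only [nematicField, nematic, Matrix.smul_apply, Matrix.add_apply, Matrix.vecMulVec_apply,
    Matrix.one_apply, eq_comm (a := i), mul_comm]

theorem nematicField_two_castSucc (r δ : ℝ) (n : (Fin 2 → ℝ) → (Fin 2 → ℝ)) (x : Fin 2 → ℝ)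
    (j : Fin 2) : nematicField r δ n x 2 j.castSucc = 0 := by
  fin_cases j <;> simp [nematicField, nematic]

theorem nematicField_two_two (r δ : ℝ) (n : (Fin 2 → ℝ) → (Fin 2 → ℝ)) (x : Fin 2 → ℝ) :
    nematicField r δ n x 2 2 = r ^ (2 * δ) := by
  simp [nematicField, nematic]

theorem principal2_nematicField (r δ : ℝ) (n : (Fin 2 → ℝ) → (Fin 2 → ℝ)) (x : Fin 2 → ℝ)
    (i j : Fin 2) :
    principal2 (nematicField r δ n x) i j = r ^ (2 * δ) * planarField r n x i j := by
  fin_cases i <;> fin_cases j <;>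
    simp [principal2, nematicField, nematic, planarField, Matrix.vecMulVec_apply, mul_add]

theorem planarField_symm (r : ℝ) (n : (Fin 2 → ℝ) → (Fin 2 → ℝ)) (x : Fin 2 → ℝ)
    (i j : Fin 2) : planarField r n x i j = planarField r n x j i := by
  simp only [planarField, Matrix.smul_apply, Matrix.add_apply, Matrix.vecMulVec_apply,
    Matrix.one_apply, eq_comm (a := i), mul_comm]

theorem planarField_trace {x : Fin 2 → ℝ} (hn : n x 0 ^ 2 + n x 1 ^ 2 = 1) :
    planarField r n x 0 0 + planarField r n x 1 1 = r ^ 2 + 1 := by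
  simp [planarField, Matrix.vecMulVec_apply]
  linear_combination (r ^ 2 - 1) * hn

theorem planarField_det {x : Fin 2 → ℝ} (hn : n x 0 ^ 2 + n x 1 ^ 2 = 1) :
    planarField r n x 0 0 * planarField r n x 1 1 - planarField r n x 0 1 ^ 2 = r ^ 2 := by
  simp [planarField, Matrix.vecMulVec_apply]
  linear_combination (r ^ 2 - 1) * hn

end Nematic

end NematicPlate

theorem theorem8p1 (Ω : Set (Fin 2 → ℝ)) (hΩ : IsOpen Ω) (hΩs : IsSimplyConnected Ω)
    (r δ : ℝ) (hr : 0 < r) (n : (Fin 2 → ℝ) → (Fin 2 → ℝ))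
    (hn : ∀ x ∈ Ω, n x 0 ^ 2 + n x 1 ^ 2 = 1)
    (hG : ∀ i j, ContDiffOn ℝ ∞ (fun x => NematicPlate.nematicField r δ n x i j) Ω) :
    List.TFAE [
      NematicPlate.Immersible (NematicPlate.plate Ω 1)
        (NematicPlate.uniformThrough (NematicPlate.nematicField r δ n)),
      ∀ x ∈ Ω, NematicPlate.gaussCurvature (NematicPlate.planarField r n) x = 0,
      ∀ x ∈ Ω, NematicPlate.curlTcurl
        (fun y => NematicPlate.principal2 (NematicPlate.nematicField r δ n y)) x = 0,
      ∀ x ∈ NematicPlate.plate Ω 1,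
        NematicPlate.riemann
          (NematicPlate.uniformThrough (NematicPlate.nematicField r δ n)) 2 0 0 1 x = 0 ∧
        NematicPlate.riemann
          (NematicPlate.uniformThrough (NematicPlate.nematicField r δ n)) 2 1 1 0 x = 0 ∧
        NematicPlate.riemannCov
          (NematicPlate.uniformThrough (NematicPlate.nematicField r δ n)) 0 1 0 1 x = 0] := by
  open NematicPlate in
  have hc : 0 < r ^ (2 * δ) := Real.rpow_pos_of_pos hr _
  have hr2 : r ^ 2 ≠ 0 := by positivity
  have hsq : (r ^ δ) ^ 2 = r ^ (2 * δ) := by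
    rw [← Real.rpow_natCast, ← Real.rpow_mul hr.le]
    congr 1
    push_cast
    ring
  -- Smoothness must come from G, since n itself is not assumed smooth.
  have hg : ∀ i j, ContDiffOn ℝ ∞ (fun x => planarField r n x i j) Ω := by
    intro i j
    refine (contDiffOn_const (c := (r ^ (2 * δ))⁻¹)).mul (hG i.castSucc j.castSucc) |>.congr ?_
    intro x _
    have h := principal2_nematicField r δ n x i j
    rw [principal2, Matrix.submatrix_apply] at h
    rw [h, inv_mul_cancel_left₀ hc.ne']
  -- The square root of `G_{2×2}` has eigenvalues r^δ and r^(δ+1). Their sum is τ = r^δ (r + 1),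
  -- their product ρ = r^(2δ) r.
  have htr : ∀ x ∈ Ω, principal2 (nematicField r δ n x) 0 0
      + principal2 (nematicField r δ n x) 1 1
        = (r ^ δ * (r + 1)) ^ 2 - 2 * (r ^ (2 * δ) * r) := by
    intro x hx
    rw [principal2_nematicField, principal2_nematicField, mul_pow, hsq]
    linear_combination r ^ (2 * δ) * planarField_trace (r := r) (hn x hx)
  have hdet2 : ∀ x ∈ Ω, principal2 (nematicField r δ n x) 0 0
      * principal2 (nematicField r δ n x) 1 1 - principal2 (nematicField r δ n x) 0 1 ^ 2
        = (r ^ (2 * δ) * r) ^ 2 := by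
    intro x hx
    rw [principal2_nematicField, principal2_nematicField, principal2_nematicField]
    linear_combination (r ^ (2 * δ)) ^ 2 * planarField_det (r := r) (hn x hx)
  have hGsymm := nematicField_symm r δ n
  have hdet2' : ∀ x ∈ Ω, (principal2 (nematicField r δ n x)).det ≠ 0 := by
    intro x hx
    have h : (principal2 (nematicField r δ n x)).det = (r ^ (2 * δ) * r) ^ 2 := by
      rw [← hdet2 x hx, Matrix.det_fin_two]
      have : principal2 (nematicField r δ n x) 1 0 = principal2 (nematicField r δ n x) 0 1 :=
        hGsymm x _ _
      rw [this, pow_two (principal2 (nematicField r δ n x) 0 1)]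
    rw [h]
    positivity
  have hdet : ∀ x ∈ Ω, (nematicField r δ n x).det ≠ 0 := by
    intro x hx
    have h20 : nematicField r δ n x 2 0 = 0 := nematicField_two_castSucc r δ n x 0
    have h21 : nematicField r δ n x 2 1 = 0 := nematicField_two_castSucc r δ n x 1
    have h : (nematicField r δ n x).det
        = r ^ (2 * δ) * (principal2 (nematicField r δ n x)).det := by
      rw [Matrix.det_fin_three, Matrix.det_fin_two, h20, h21, nematicField_two_two]
      simp only [principal2, Matrix.submatrix_apply, Fin.castSucc_zero, Fin.castSucc_one]
      ring
    rw [h]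
    exact mul_ne_zero hc.ne' (hdet2' x hx)
  have hplate : ∀ x ∈ plate Ω 1, midProj x ∈ Ω := fun x hx => by
    rw [midProj_apply]; exact hx.1
  tfae_have 1 → 4 := by
    rintro ⟨u, hu, huG⟩ x hx
    have hflat := riemann_eq_zero_of_jacobian (isOpen_plate hΩ 1) hu huG
      (fun y hy => by rw [uniformThrough_eq]; exact hdet _ (hplate y hy)) hx
    exact ⟨hflat _ _ _ _, hflat _ _ _ _, by simp [riemannCov, hflat]⟩
  tfae_have 4 → 3 := by
    intro h x hx
    have hpx : midProj ![x 0, x 1, 0] = x := by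
      rw [midProj_apply]; ext i; fin_cases i <;> rfl
    have hmem : ![x 0, x 1, 0] ∈ plate Ω 1 := by
      refine ⟨?_, by simp⟩
      rw [← midProj_apply, hpx]
      exact hx
    have h0 := (h _ hmem).2.2
    have h1 := riemannCov_uniformThrough hΩ hG hGsymm (nematicField_two_castSucc r δ n) hdet hdet2'
      (hplate _ hmem) 0 1 0 1
    rw [hpx, riemannCov_eq_curlTcurl (h := fun y => principal2 (nematicField r δ n y)) hΩ
      (fun i j => hG i.castSucc j.castSucc)
      (fun x i j => hGsymm x _ _) htr hdet2 (by positivity) hx] at h1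
    have h2 := h1.symm.trans h0
    linarith
  tfae_have 2 ↔ 3 := by
    refine forall₂_congr fun x hx => ?_
    have hd : (planarField r n x).det = r ^ 2 := by
      rw [← planarField_det (hn x hx), Matrix.det_fin_two, planarField_symm r n x 1 0, pow_two]
    rw [gaussCurvature, hd, div_eq_zero_iff, or_iff_left hr2,
      riemannCov_eq_curlTcurl hΩ hg (planarField_symm r n)
        (fun y hy => planarField_trace (hn y hy)) (fun y hy => planarField_det (hn y hy)) hr2 hx,
      curlTcurl_const_smul hΩ hg _ hx (principal2_nematicField r δ n)]
    simp [hc.ne']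
  tfae_have 3 → 1 := by
    intro h
    obtain ⟨v, hv, hvG⟩ := exists_map_of_curlTcurl_eq_zero hΩ hΩs
      (fun i j => hG i.castSucc j.castSucc) (fun x i j => hGsymm x _ _)
      (mul_ne_zero hc.ne' hr.ne') (by positivity) htr hdet2 h
    exact immersible_uniformThrough hΩ 1 (r ^ δ) hGsymm (nematicField_two_castSucc r δ n)
      (fun x => by rw [hsq, nematicField_two_two]) hv hvG
  tfae_finish
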